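/- **Setting.** Let $(\mathsf X_n,\mathcal X_n)_{n\in\mathbb N}$ be measurable spaces, $\eta_0$ a probability measure on $\mathsf X_0$, $g_n:\mathsf X_n\to\mathbb R_+$ bounded measurable potentials, and $M_n$ Markov kernels from $\mathsf X_n$ to $\mathsf X_{n+1}$ with jointly measurable transition densities $m_n(x,y)$ with respect to $\sigma$-finite measures. Let $Q_n(x,dy)=g_n(x)M_n(x,dy)$, with density $q_n(x,y)=g_n(x)m_n(x,y)$, and let $\eta_{0:n}$ be the normalisation to a probability measure of $$\gamma_{0:n}(dx_{0:n})=\eta_0(dx_0)\prod_{m=0}^{n-1}Q_m(x_m,dx_{m+1}).$$ Given $N\in\mathbb N^*$ and a path $z=(z_m)_m$, $z_m\in\mathsf X_m$, the frozen-path model is defined by $\eta^z_0=(1-\frac1N)\eta_0+\frac1N\delta_{z_0}$, $$Q^z_m(x,\cdot)=\Big(1-\frac1N\Big)Q_m(x,\cdot)+\frac1N g_m(x)\,\delta_{z_{m+1}},$$ $\eta^z_m$ the normalisation of $\eta^z_0Q^z_0\cdots Q^z_{m-1}$, and $$\eta^z_{0:n}(dx_{0:n})=\eta^z_n(dx_n)\prod_{m=0}^{n-1}B_{m,\eta^z_m}(x_{m+1},dx_m),\qquad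 B_{m,\eta}(y,dx)=\frac{q_m(x,y)\,\eta(dx)}{\int q_m(x',y)\,\eta(dx')}.$$ For bounded measurable $\tilde h_m:\mathsf X_m\times\mathsf X_{m+1}\to\mathbb R$ put $h_n(x_{0:n})=\sum_{m=0}^{n-1}\tilde h_m(x_m,x_{m+1})$. **Strong mixing.** For every $n$ there are positive constants $\underline g_n,\bar g_n,\underline m_n,\bar m_n$ such that $\underline g_n\le g_n\le\bar g_n$ and $\underline m_n\le m_n\le\bar m_n$ everywhere. Let $$\rho_n=\max_{0\le m\le n}\frac{\bar g_m\,\bar m_m}{\underline g_m\,\underline m_m}.$$ **Proposition.** For every $\rho\in\mathbb R$ there exists $\mathsf c>0$, depending on $\rho$ only, such that for every Feynman–Kac model as above satisfying strong mixing, every $n\in\mathbb N$ with $\rho_n\le\rho$, every $N\in\mathbb N^*$, every path $z$, and all bounded measurable $\tilde h_m$, $m\in\mathbb N$, $$\Big|\int h_n\,d\eta^{z}_{0:n}-\int h_n\,d\eta_{0:n}\Big|\le \mathsf c\,N^{-1}\sum_{m=0}^{n-1}\|\tilde h_m\|_\infty .$$ In particular, the constant is uniform in $n$ whenever $\sup_n\rho_n<\infty$;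 and under strong mixing alone the bound holds for every $n$ with a constant that depends on $n$ through $\rho_n$ only. -/

import Mathlib

open MeasureTheory ProbabilityTheory
open scoped NNReal ENNReal

universe u

noncomputable section

/-- A Feynman--Kac model on the state spaces `X 0, X 1, …`: an initial distribution, Markov
kernels `M n` from `X n` to `X (n + 1)` admitting transition densities `m n` with respect to
`σ`-finite dominating measures, and bounded measurable potentials `g n`. -/
structure FeynmanKac (X : ℕ → Type u) [∀ n, MeasurableSpace (X n)] where
  /-- the initial distribution -/
  init : Measure (X 0)
  init_prob : IsProbabilityMeasure init
  /-- the Markov transition kernels -/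
  M : ∀ n, Kernel (X n) (X (n + 1))
  M_markov : ∀ n, IsMarkovKernel (M n)
  /-- the potential functions -/
  g : ∀ n, X n → ℝ≥0
  g_meas : ∀ n, Measurable (g n)
  g_bdd : ∀ n, ∃ C : ℝ≥0, ∀ x, g n x ≤ C
  /-- the dominating measures: `ref n` is a measure on `X (n + 1)` -/
  ref : ∀ n, Measure (X (n + 1))
  ref_sigmaFinite : ∀ n, SigmaFinite (ref n)
  /-- the transition densities -/
  m : ∀ n, X n → X (n + 1) → ℝ≥0
  m_meas : ∀ n, Measurable (Function.uncurry (m n))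
  M_eq : ∀ n x, M n x = (ref n).withDensity (fun y => (m n x y : ℝ≥0∞))

/-- Appending the state `x_n` to the path `x_{0:n-1}`, which gives the path `x_{0:n}`. Paths
`x_{0:n}` are elements of `∀ i : Fin (n + 1), X i`. -/
def appendState (X : ℕ → Type u) (n : ℕ) (p : (∀ i : Fin n, X i) × X n) :
    ∀ i : Fin (n + 1), X i :=
  Fin.snoc (α := fun i : Fin (n + 1) => X i) p.1 p.2

/-- The additive functional `h_n(x_{0:n}) = ∑_{m < n} h̃_m(x_m, x_{m+1})`. -/
def additiveFunctional {X : ℕ → Type u} (h : ∀ m, X m × X (m + 1) → ℝ) (n : ℕ)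
    (x : ∀ i : Fin (n + 1), X i) : ℝ :=
  ∑ m : Fin n, h m (x m.castSucc, x m.succ)

/-- The supremum norm of a (bounded) function. -/
def supNorm {α : Type u} (f : α → ℝ) : ℝ := ⨆ a, |f a|

/-- `ρ_n = max_{0 ≤ m ≤ n} (gHigh_m mHigh_m) / (gLow_m mLow_m)`. -/
def mixingRatio (gLow gHigh mLow mHigh : ℕ → ℝ) (n : ℕ) : ℝ :=
  (Finset.range (n + 1)).sup' Finset.nonempty_range_add_one
    (fun m => gHigh m * mHigh m / (gLow m * mLow m))

namespace FeynmanKac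

variable {X : ℕ → Type u} [∀ n, MeasurableSpace (X n)] (F : FeynmanKac X)

/-- The strong mixing assumption, with given constants. -/
structure StrongMixing (gLow gHigh mLow mHigh : ℕ → ℝ) : Prop where
  gLow_pos : ∀ n, 0 < gLow n
  gHigh_pos : ∀ n, 0 < gHigh n
  mLow_pos : ∀ n, 0 < mLow n
  mHigh_pos : ∀ n, 0 < mHigh n
  g_bounds : ∀ n x, gLow n ≤ F.g n x ∧ (F.g n x : ℝ) ≤ gHigh n
  m_bounds : ∀ n x y, mLow n ≤ F.m n x y ∧ (F.m n x y : ℝ) ≤ mHigh n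

/-- The unnormalised kernel `Q_n(x, A) = g_n(x) M_n(x, A)`. -/
def Q (n : ℕ) : Kernel (X n) (X (n + 1)) where
  toFun x := F.g n x • F.M n x
  measurable' := by
    refine Measure.measurable_of_measurable_coe _ fun s hs => ?_
    exact (measurable_coe_nnreal_ennreal.comp (F.g_meas n)).mul ((F.M n).measurable_coe hs)

instance instIsFiniteKernelQ (n : ℕ) : IsFiniteKernel (F.Q n) := by
  obtain ⟨C, hC⟩ := F.g_bdd n
  have := F.M_markov n
  refine ⟨⟨C, ENNReal.coe_lt_top, fun x => ?_⟩⟩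
  change (F.g n x : ℝ≥0∞) * F.M n x Set.univ ≤ C
  rw [measure_univ, mul_one]
  exact_mod_cast hC x

/-- The density `q_n(x, y) = g_n(x) m_n(x, y)` of `Q_n`. -/
def q (n : ℕ) (x : X n) (y : X (n + 1)) : ℝ≥0 := F.g n x * F.m n x y

/-- The unnormalised path measures
`γ_{0:n}(dx_{0:n}) = η_0(dx_0) ∏_{m < n} Q_m(x_m, dx_{m+1})`. -/
def unnormPath : ∀ n : ℕ, Measure (∀ i : Fin (n + 1), X i)
  | 0 => F.init.map fun x => appendState X 0 (fun i => i.elim0, x)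
  | n + 1 =>
    (unnormPath n ⊗ₘ (F.Q n).comap (fun p : ∀ i : Fin (n + 1), X i => p (Fin.last n))
      (measurable_pi_apply _)).map (appendState X (n + 1))

/-- The Feynman--Kac path measure `η_{0:n} = γ_{0:n} / γ_{0:n}(X_{0:n})`. -/
def path (n : ℕ) : Measure (∀ i : Fin (n + 1), X i) :=
  (F.unnormPath n Set.univ)⁻¹ • F.unnormPath n

/-- The backward kernel
`B_{n,η}(y, A) = ∫ 1_A(x) q_n(x, y) η(dx) / ∫ q_n(x, y) η(dx)`. -/
def backward (n : ℕ) (η : Measure (X n)) [SFinite η] : Kernel (X (n + 1)) (X n) :=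
  (Kernel.const (X (n + 1)) η).withDensity
    fun y x => (F.q n x y : ℝ≥0∞) / ∫⁻ x', (F.q n x' y : ℝ≥0∞) ∂η

/-! ### The model with a frozen path `z` -/

variable (N : ℕ) (z : ∀ m, X m)

/-- The frozen-path initial distribution `(1 - 1/N) η_0 + (1/N) δ_{z_0}`. -/
def frozenInit : Measure (X 0) :=
  (1 - (N : ℝ≥0)⁻¹) • F.init + (N : ℝ≥0)⁻¹ • Measure.dirac (z 0)

instance instIsFiniteMeasureFrozenInit : IsFiniteMeasure (F.frozenInit N z) := by
  have := F.init_prob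
  unfold frozenInit
  infer_instance

/-- The frozen-path kernel `(1 - 1/N) Q_n(x, ·) + (1/N) g_n(x) δ_{z_{n+1}}`. -/
def frozenQ (n : ℕ) : Kernel (X n) (X (n + 1)) where
  toFun x := (1 - (N : ℝ≥0)⁻¹) • F.Q n x +
    ((N : ℝ≥0)⁻¹ * F.g n x) • Measure.dirac (z (n + 1))
  measurable' := by
    refine Measure.measurable_of_measurable_coe _ fun s hs => ?_
    exact (((F.Q n).measurable_coe hs).const_mul _).add
      ((measurable_coe_nnreal_ennreal.comp ((F.g_meas n).const_mul _)).mul_const _)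

instance instIsFiniteKernelFrozenQ (n : ℕ) : IsFiniteKernel (F.frozenQ N z n) := by
  obtain ⟨C, hC⟩ := F.g_bdd n
  have := F.M_markov n
  refine ⟨⟨((1 - (N : ℝ≥0)⁻¹) * C + (N : ℝ≥0)⁻¹ * C : ℝ≥0), ENNReal.coe_lt_top, fun x => ?_⟩⟩
  change ((1 - (N : ℝ≥0)⁻¹ : ℝ≥0) : ℝ≥0∞) * ((F.g n x : ℝ≥0∞) * F.M n x Set.univ) +
    (((N : ℝ≥0)⁻¹ * F.g n x : ℝ≥0) : ℝ≥0∞) * Measure.dirac (z (n + 1)) Set.univ ≤ _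
  rw [measure_univ, measure_univ, mul_one, mul_one]
  norm_cast
  gcongr <;> exact hC x

/-- The unnormalised frozen-path marginals `γ^z_n = η^z_0 Q^z_0 ⋯ Q^z_{n-1}`. -/
def frozenUnnorm : ∀ n : ℕ, Measure (X n)
  | 0 => F.frozenInit N z
  | n + 1 => (frozenUnnorm n).bind (F.frozenQ N z n)

instance instIsFiniteMeasureFrozenUnnorm (n : ℕ) : IsFiniteMeasure (F.frozenUnnorm N z n) := by
  induction n with
  | zero => exact F.instIsFiniteMeasureFrozenInit N z
  | succ n ih => unfold frozenUnnorm; infer_instance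

/-- The normalised frozen-path marginals `η^z_n = γ^z_n / γ^z_n(X_n)`. -/
def frozenMarginal (n : ℕ) : Measure (X n) :=
  (F.frozenUnnorm N z n Set.univ)⁻¹ • F.frozenUnnorm N z n

instance instSFiniteFrozenMarginal (n : ℕ) : SFinite (F.frozenMarginal N z n) := by
  unfold frozenMarginal
  infer_instance

/-- The kernels
`R^z_n(x_n, dx_{0:n-1}) = ∏_{m < n} B_{m,η^z_m}(x_{m+1}, dx_m)`. -/
def frozenR : ∀ n : ℕ, Kernel (X n) (∀ i : Fin n, X i)
  | 0 => Kernel.const (X 0) (Measure.dirac fun i => i.elim0)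
  | n + 1 =>
    (F.backward n (F.frozenMarginal N z n) ⊗ₖ
      Kernel.prodMkLeft (X (n + 1)) (frozenR n)).map
        fun p : X n × (∀ i : Fin n, X i) => appendState X n (p.2, p.1)

/-- The frozen-path path model
`η^z_{0:n}(dx_{0:n}) = η^z_n(dx_n) R^z_n(x_n, dx_{0:n-1})`. -/
def frozenPath (n : ℕ) : Measure (∀ i : Fin (n + 1), X i) :=
  (F.frozenMarginal N z n ⊗ₘ F.frozenR N z n).map fun p => appendState X n (p.2, p.1)

end FeynmanKac

end

/-!
Both path measures are Markov chains run backwards in time: the law of the last state is a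
(normalised) marginal of a forward flow, and the transitions are the backward kernels
`B_{m,η_m}(y, dx) ∝ q_m(x, y) η_m(dx)`. For the frozen-path measure this is the definition; for the
original one it is `FeynmanKac.integral_additiveFunctional_mul_unnormPath`. So everything is
expressed through weighted means `η(w f) / η(w)`, which do not depend on the normalisation of `η`,
and strong mixing enters only through the fact that `q_m` takes its values in an interval
`[a, ρ a]` with `a > 0`.

The forward flows `γ^z_n` and `γ_n` are compared through weighted means whose weight varies by a
factor at most `ρ` (`FeynmanKac.abs_weightedMean_frozenUnnorm_sub_le`). A step of the frozen-path
flow is a step of the original one followed by mixing in a Dirac mass with proportion `1 / N`, which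
costs `ρ / N` times the oscillation of `f`. The weighted mean of `γ Q_n` for `(w, f)` is the one of
`γ` for `(Q_n w, Q_n (w f) / Q_n w)`; the new weight again varies by a factor at most `ρ`, and the
oscillation of the new function is smaller by the factor `1 - 1 / ρ`, by the Dobrushin contraction
`weightedMean_mem_contracted`. The errors add up to `ρ ^ 2 / N`, uniformly in time.

Taking `w = q_n(·, y)`, the same estimate compares the backward kernels of the two flows. The
conditional expectations of `h_n` given the last state satisfy the same backward recursion for both
measures. Their oscillation is controlled by Dobrushin contraction once more, and their distance by
the comparison of the backward kernels; a suitable combination of the two quantities grows by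
`O(‖h̃_n‖ / N)` in each step (`FeynmanKac.exists_backwardMean_frozenUnnorm_close`). This gives the
constant `2 ρ ^ 2 + 2 ρ ^ 3`.
-/

/-! ### Bounded measurable functions -/

/-- A real function that is measurable and bounded. -/
structure IsBoundedMeasurable {α : Type*} [MeasurableSpace α] (f : α → ℝ) : Prop where
  measurable : Measurable f
  bounded : ∃ C : ℝ, ∀ x, |f x| ≤ C

namespace IsBoundedMeasurable

variable {α β : Type*} [MeasurableSpace α] [MeasurableSpace β] {f k : α → ℝ}

lemma of_mem_Icc {a b : ℝ} (hf : Measurable f) (h : ∀ x, a ≤ f x ∧ f x ≤ b) :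
    IsBoundedMeasurable f :=
  ⟨hf, max |a| |b|, fun x => abs_le_max_abs_abs (h x).1 (h x).2⟩

lemma const (c : ℝ) : IsBoundedMeasurable fun _ : α => c :=
  ⟨measurable_const, |c|, fun _ => le_rfl⟩

lemma add (hf : IsBoundedMeasurable f) (hk : IsBoundedMeasurable k) :
    IsBoundedMeasurable fun x => f x + k x := by
  obtain ⟨C, hC⟩ := hf.bounded
  obtain ⟨D, hD⟩ := hk.bounded
  exact ⟨hf.measurable.add hk.measurable, C + D,
    fun x => (abs_add_le _ _).trans (add_le_add (hC x) (hD x))⟩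

lemma mul (hf : IsBoundedMeasurable f) (hk : IsBoundedMeasurable k) :
    IsBoundedMeasurable fun x => f x * k x := by
  obtain ⟨C, hC⟩ := hf.bounded
  obtain ⟨D, hD⟩ := hk.bounded
  refine ⟨hf.measurable.mul hk.measurable, C * D, fun x => ?_⟩
  rw [abs_mul]
  exact mul_le_mul (hC x) (hD x) (abs_nonneg _) ((abs_nonneg _).trans (hC x))

lemma sub (hf : IsBoundedMeasurable f) (hk : IsBoundedMeasurable k) :
    IsBoundedMeasurable fun x => f x - k x := by
  have := hf.add ((const (-1)).mul hk)
  simpa [sub_eq_add_neg] using this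

lemma comp (hf : IsBoundedMeasurable f) {φ : β → α} (hφ : Measurable φ) :
    IsBoundedMeasurable fun y => f (φ y) := by
  obtain ⟨C, hC⟩ := hf.bounded
  exact ⟨hf.measurable.comp hφ, C, fun y => hC _⟩

lemma integrable (hf : IsBoundedMeasurable f) (μ : Measure α) [IsFiniteMeasure μ] :
    Integrable f μ := by
  obtain ⟨C, hC⟩ := hf.bounded
  exact .of_bound hf.measurable.aestronglyMeasurable C (ae_of_all _ hC)

lemma integral_right {f : α × β → ℝ} (hf : IsBoundedMeasurable f) (ν : Measure β)
    [IsFiniteMeasure ν] : IsBoundedMeasurable fun x => ∫ y, f (x, y) ∂ν := by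
  obtain ⟨C, hC⟩ := hf.bounded
  refine ⟨(hf.measurable.stronglyMeasurable.integral_prod_right' (ν := ν)).measurable,
    C * ν.real Set.univ, fun x => ?_⟩
  exact norm_integral_le_of_norm_le_const (f := fun y => f (x, y))
    (ae_of_all _ fun y => hC (x, y))

lemma integral_left {f : α × β → ℝ} (hf : IsBoundedMeasurable f) (μ : Measure α)
    [IsFiniteMeasure μ] : IsBoundedMeasurable fun y => ∫ x, f (x, y) ∂μ :=
  (hf.comp measurable_swap).integral_right μ

end IsBoundedMeasurable

/-! ### Weighted means -/

/-- The mean of `f` under the probability measure proportional to `w dμ`. It depends on `μ` and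
`w` only up to scaling. -/
noncomputable def weightedMean {α : Type*} [MeasurableSpace α] (μ : Measure α) (w f : α → ℝ) :
    ℝ :=
  (∫ x, w x * f x ∂μ) / ∫ x, w x ∂μ

section WeightedMean

variable {α : Type*} [MeasurableSpace α] {μ : Measure α} {w f k : α → ℝ} {a : ℝ}

lemma weightedMean_smul_measure {c : ℝ≥0∞} (h0 : c ≠ 0) (hc : c ≠ ∞) (w f : α → ℝ) :
    weightedMean (c • μ) w f = weightedMean μ w f := by
  simp only [weightedMean, integral_smul_measure, smul_eq_mul]
  exact mul_div_mul_left _ _ (ENNReal.toReal_ne_zero.2 ⟨h0, hc⟩)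

variable [IsFiniteMeasure μ]

lemma mul_measureReal_univ_le_integral (hw : IsBoundedMeasurable w) (h : ∀ x, a ≤ w x) :
    a * μ.real Set.univ ≤ ∫ x, w x ∂μ := by
  have := integral_mono (integrable_const a) (hw.integrable μ) h
  simpa [mul_comm] using this

lemma integral_pos_of_pos_le [NeZero μ] (hw : IsBoundedMeasurable w) (ha : 0 < a)
    (h : ∀ x, a ≤ w x) : 0 < ∫ x, w x ∂μ :=
  (mul_pos ha measureReal_univ_pos).trans_le (mul_measureReal_univ_le_integral hw h)

lemma weightedMean_add (hw : IsBoundedMeasurable w) (hf : IsBoundedMeasurable f)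
    (hk : IsBoundedMeasurable k) :
    weightedMean μ w (fun x => f x + k x) = weightedMean μ w f + weightedMean μ w k := by
  simp only [weightedMean, mul_add]
  rw [integral_add ((hw.mul hf).integrable μ) ((hw.mul hk).integrable μ), add_div]

lemma weightedMean_sub (hw : IsBoundedMeasurable w) (hf : IsBoundedMeasurable f)
    (hk : IsBoundedMeasurable k) :
    weightedMean μ w (fun x => f x - k x) = weightedMean μ w f - weightedMean μ w k := by
  simp only [weightedMean, mul_sub]
  rw [integral_sub ((hw.mul hf).integrable μ) ((hw.mul hk).integrable μ), sub_div]

lemma weightedMean_mem [NeZero μ] (hw : IsBoundedMeasurable w) (ha : 0 < a) (h : ∀ x, a ≤ w x)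
    (hf : Measurable f) {l r : ℝ} (hlr : ∀ x, l ≤ f x ∧ f x ≤ r) :
    l ≤ weightedMean μ w f ∧ weightedMean μ w f ≤ r := by
  have hp := integral_pos_of_pos_le (μ := μ) hw ha h
  have hi := (hw.mul (.of_mem_Icc hf hlr)).integrable μ
  have h0 : ∀ x, 0 ≤ w x := fun x => ha.le.trans (h x)
  unfold weightedMean
  rw [le_div_iff₀ hp, div_le_iff₀ hp, ← integral_const_mul, ← integral_const_mul]
  constructor
  · refine integral_mono ((hw.integrable μ).const_mul _) hi fun x => ?_
    rw [mul_comm]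
    exact mul_le_mul_of_nonneg_left (hlr x).1 (h0 x)
  · refine integral_mono hi ((hw.integrable μ).const_mul _) fun x => ?_
    rw [mul_comm]
    exact mul_le_mul_of_nonneg_right (hlr x).2 (h0 x)

lemma abs_weightedMean_le [NeZero μ] (hw : IsBoundedMeasurable w) (ha : 0 < a)
    (h : ∀ x, a ≤ w x) (hf : Measurable f) {C : ℝ} (hC : ∀ x, |f x| ≤ C) :
    |weightedMean μ w f| ≤ C :=
  abs_le.2 (weightedMean_mem hw ha h hf fun x => abs_le.1 (hC x))

/-- **Dobrushin contraction.** Two weights that are both comparable to `u`, with the same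
constants, give means of `f` in a common interval whose length is the oscillation of `f` times
`1 - 1 / ρ`: the probability measure proportional to `w dμ` dominates `1 / ρ` times the one
proportional to `u dμ`, whatever `w` is. -/
lemma weightedMean_mem_contracted [NeZero μ] {u : α → ℝ} {ρ b l D : ℝ} (hρ : 1 ≤ ρ)
    (hu : IsBoundedMeasurable u) (ha : 0 < a) (hau : ∀ x, a ≤ u x) (hb : 0 < b)
    (hw : Measurable w) (hwu : ∀ x, b * u x ≤ w x ∧ w x ≤ ρ * b * u x)
    (hf : Measurable f) (hl : ∀ x, l ≤ f x ∧ f x ≤ l + D) :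
    ρ⁻¹ * weightedMean μ u f + (1 - ρ⁻¹) * l ≤ weightedMean μ w f ∧
      weightedMean μ w f ≤
        ρ⁻¹ * weightedMean μ u f + (1 - ρ⁻¹) * l + (1 - ρ⁻¹) * D := by
  have hρ0 : 0 < ρ := by linarith
  have hfB : IsBoundedMeasurable f := .of_mem_Icc hf hl
  have hwB : IsBoundedMeasurable w := by
    obtain ⟨C, hC⟩ := hu.bounded
    refine .of_mem_Icc (a := b * a) (b := ρ * b * C) hw fun x => ⟨?_, ?_⟩
    · exact (mul_le_mul_of_nonneg_left (hau x) hb.le).trans (hwu x).1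
    · exact (hwu x).2.trans (mul_le_mul_of_nonneg_left ((le_abs_self _).trans (hC x))
        (by positivity))
  have hU := integral_pos_of_pos_le (μ := μ) hu ha hau
  have hW := integral_pos_of_pos_le (μ := μ) hwB (mul_pos hb ha)
    fun x => (mul_le_mul_of_nonneg_left (hau x) hb.le).trans (hwu x).1
  set U := ∫ x, u x ∂μ with hUdef
  set W := ∫ x, w x ∂μ with hWdef
  have hWU : W ≤ ρ * b * U := by
    rw [hWdef, hUdef, ← integral_const_mul]
    exact integral_mono (hwB.integrable μ) ((hu.integrable μ).const_mul _) fun x => (hwu x).2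
  -- the weight left over when the part proportional to `u` is taken out of `w`
  set t := W / (ρ * U) with ht
  have htb : t ≤ b := by
    rw [ht, div_le_iff₀ (by positivity)]
    linarith
  have hv : ∀ x, 0 ≤ w x - t * u x := fun x =>
    sub_nonneg.2 ((mul_le_mul_of_nonneg_right htb (ha.le.trans (hau x))).trans (hwu x).1)
  have hvB : IsBoundedMeasurable fun x => w x - t * u x :=
    hwB.sub ((IsBoundedMeasurable.const t).mul hu)
  have key : ∀ c : ℝ, ∫ x, (w x - t * u x) * (f x - c) ∂μ =
      W * (weightedMean μ w f - (ρ⁻¹ * weightedMean μ u f + (1 - ρ⁻¹) * c)) := by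
    intro c
    have i1 := (hwB.mul hfB).integrable μ
    have i2 := (hu.mul hfB).integrable μ
    have e : ∀ x, (w x - t * u x) * (f x - c) =
        (w x * f x - t * (u x * f x)) - (c * w x - c * t * u x) := fun x => by ring
    simp_rw [e]
    have i3 : Integrable (fun x => w x * f x - t * (u x * f x)) μ := i1.sub (i2.const_mul _)
    have i4 : Integrable (fun x => c * w x - c * t * u x) μ :=
      ((hwB.integrable μ).const_mul _).sub ((hu.integrable μ).const_mul _)
    rw [integral_sub i3 i4,
      integral_sub i1 (i2.const_mul _),
      integral_sub ((hwB.integrable μ).const_mul _) ((hu.integrable μ).const_mul _),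
      integral_const_mul, integral_const_mul, integral_const_mul, weightedMean, weightedMean,
      ← hUdef, ← hWdef, ht]
    field_simp
    ring
  have k1 : 0 ≤ ∫ x, (w x - t * u x) * (f x - l) ∂μ :=
    integral_nonneg fun x => mul_nonneg (hv x) (sub_nonneg.2 (hl x).1)
  have k2 : ∫ x, (w x - t * u x) * (f x - (l + D)) ∂μ ≤ 0 :=
    integral_nonpos fun x => mul_nonpos_of_nonneg_of_nonpos (hv x) (sub_nonpos.2 (hl x).2)
  rw [key] at k1 k2
  have k1 := nonneg_of_mul_nonneg_right k1 hW
  have k2 := nonpos_of_mul_nonpos_right k2 hW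
  constructor <;> linarith

/-- Moving a proportion `t` of the total mass `c` of a measure to a single point moves the means of `f` by at most
`t * ρ` times the oscillation of `f`, when the values of the weight are within a factor `ρ`. -/
lemma abs_weightedMean_add_dirac_sub_le [NeZero μ] {t c : ℝ≥0} {ρ l D : ℝ} (ht : t ≤ 1)
    (hw : Measurable w) (ha : 0 < a) (h : ∀ x, a ≤ w x ∧ w x ≤ ρ * a)
    (hf : Measurable f) (hl : ∀ x, l ≤ f x ∧ f x ≤ l + D) (hmass : (c : ℝ) = μ.real Set.univ)
    (z : α) :
    |weightedMean ((1 - t) • μ + (t * c) • Measure.dirac z) w f - weightedMean μ w f| ≤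
      t * ρ * D := by
  have hwB : IsBoundedMeasurable w := .of_mem_Icc hw h
  have hwf : IsBoundedMeasurable fun x => w x * f x := hwB.mul (.of_mem_Icc hf hl)
  have hm : 0 < (c : ℝ) := hmass ▸ measureReal_univ_pos
  have hA := mul_measureReal_univ_le_integral (μ := μ) hwB fun x => (h x).1
  rw [← hmass] at hA
  have hmem := weightedMean_mem (μ := μ) hwB ha (fun x => (h x).1) hf hl
  have int : ∀ k : α → ℝ, IsBoundedMeasurable k →
      ∫ x, k x ∂((1 - t) • μ + (t * c) • Measure.dirac z) =
        (1 - t) * (∫ x, k x ∂μ) + t * c * k z := by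
    intro k hk
    rw [integral_add_measure (hk.integrable _) (hk.integrable _), integral_smul_nnreal_measure,
      integral_smul_nnreal_measure, integral_dirac' _ _ hk.measurable.stronglyMeasurable]
    simp [NNReal.smul_def, NNReal.coe_sub ht]
  set A := ∫ x, w x ∂μ with hAdef
  set m := weightedMean μ w f with hm'
  have hA0 : 0 < A := (mul_pos ha hm).trans_le hA
  have hB : ∫ x, w x * f x ∂μ = m * A := by
    rw [hm', weightedMean, ← hAdef, div_mul_cancel₀ _ hA0.ne']
  rw [weightedMean, int _ hwf, int _ hwB, hB, ← hAdef]
  have ht' : (t : ℝ) ≤ 1 := ht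
  have ht0 : (0 : ℝ) ≤ t := t.2
  have hz := h z
  have hρ : 0 < ρ := pos_of_mul_pos_left (ha.trans_le (hz.1.trans hz.2)) ha.le
  have hD0 : 0 ≤ D := by linarith [(hl z).1, (hl z).2]
  -- both terms of the new total weight are at least a multiple of `c * a`
  have hden : c * a ≤ (1 - t) * A + t * c * w z := by
    have h1 : (1 - (t : ℝ)) * (a * c) ≤ (1 - t) * A :=
      mul_le_mul_of_nonneg_left hA (by linarith)
    have h2 : (t : ℝ) * c * a ≤ t * c * w z :=
      mul_le_mul_of_nonneg_left hz.1 (by positivity)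
    nlinarith
  have hden0 : 0 < (1 - t) * A + t * c * w z := (mul_pos hm ha).trans_le hden
  have e : ((1 - t) * (m * A) + t * c * (w z * f z)) / ((1 - t) * A + t * c * w z) - m =
      t * c * w z * (f z - m) / ((1 - t) * A + t * c * w z) := by
    field_simp
    ring
  rw [e, abs_div, abs_of_pos hden0, div_le_iff₀ hden0, abs_mul,
    abs_of_nonneg (mul_nonneg (mul_nonneg ht0 hm.le) (ha.le.trans hz.1))]
  have hD : |f z - m| ≤ D := abs_le.2 ⟨by linarith [(hl z).1], by linarith [(hl z).2]⟩
  calc t * c * w z * |f z - m| ≤ t * c * (ρ * a) * D :=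
        mul_le_mul (mul_le_mul_of_nonneg_left hz.2 (by positivity)) hD (abs_nonneg _)
          (by positivity)
    _ = t * ρ * D * (c * a) := by ring
    _ ≤ _ := mul_le_mul_of_nonneg_left hden (by positivity)

end WeightedMean

lemma neZero_smul_add_smul_dirac {α : Type*} [MeasurableSpace α] (μ : Measure α)
    [IsFiniteMeasure μ] [NeZero μ] {t : ℝ≥0} (ht : t ≤ 1) (x : α) :
    NeZero ((1 - t) • μ + (t * (μ Set.univ).toNNReal) • Measure.dirac x) := by
  refine ⟨fun h0 => NeZero.ne μ (Measure.measure_univ_eq_zero.1 ?_)⟩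
  have h1 := congrArg (fun ν => ν Set.univ) h0
  have e : ((1 - t : ℝ≥0) : ℝ≥0∞) * μ Set.univ + ((t * (μ Set.univ).toNNReal : ℝ≥0) : ℝ≥0∞) =
      μ Set.univ := by
    rw [ENNReal.coe_mul, ENNReal.coe_toNNReal (measure_ne_top _ _), ← add_mul,
      ← ENNReal.coe_add, tsub_add_cancel_of_le ht, ENNReal.coe_one, one_mul]
  rw [← e]
  simpa [ENNReal.smul_def] using h1

namespace FeynmanKac

variable {X : ℕ → Type u} [∀ n, MeasurableSpace (X n)] (F : FeynmanKac X)

/-! ### Models with comparable densities -/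

/-- The values of the density `q_n` are positive and within a factor `ρ` of each other. -/
def HasComparableDensity (ρ : ℝ) (n : ℕ) : Prop :=
  ∃ a : ℝ, 0 < a ∧ ∀ x y, a ≤ F.q n x y ∧ (F.q n x y : ℝ) ≤ ρ * a

lemma StrongMixing.hasComparableDensity {F : FeynmanKac X} {gLow gHigh mLow mHigh : ℕ → ℝ}
    (hF : F.StrongMixing gLow gHigh mLow mHigh) {ρ : ℝ} {n k : ℕ}
    (hρ : mixingRatio gLow gHigh mLow mHigh n ≤ ρ) (hk : k ≤ n) :
    F.HasComparableDensity ρ k := by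
  have hpos : 0 < gLow k * mLow k := mul_pos (hF.gLow_pos k) (hF.mLow_pos k)
  refine ⟨gLow k * mLow k, hpos, fun x y => ?_⟩
  have hg := hF.g_bounds k x
  have hm := hF.m_bounds k x y
  have hr : gHigh k * mHigh k / (gLow k * mLow k) ≤ ρ :=
    (Finset.le_sup' (fun m => gHigh m * mHigh m / (gLow m * mLow m))
      (Finset.mem_range.2 (Nat.lt_succ_of_le hk))).trans hρ
  rw [div_le_iff₀ hpos] at hr
  simp only [q, NNReal.coe_mul]
  exact ⟨mul_le_mul hg.1 hm.1 (hF.mLow_pos k).le (F.g k x).2,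
    (mul_le_mul hg.2 hm.2 (F.m k x y).2 (hF.gHigh_pos k).le).trans hr⟩

lemma HasComparableDensity.mono {F : FeynmanKac X} {ρ ρ' : ℝ} {n : ℕ}
    (h : F.HasComparableDensity ρ n) (hρ : ρ ≤ ρ') : F.HasComparableDensity ρ' n := by
  obtain ⟨a, ha, hq⟩ := h
  exact ⟨a, ha, fun x y =>
    ⟨(hq x y).1, (hq x y).2.trans (mul_le_mul_of_nonneg_right hρ ha.le)⟩⟩

lemma measurable_q (n : ℕ) : Measurable fun p : X n × X (n + 1) => F.q n p.1 p.2 :=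
  ((F.g_meas n).comp measurable_fst).mul (F.m_meas n)

lemma Q_apply (n : ℕ) (x : X n) :
    F.Q n x = (F.ref n).withDensity fun y => (F.q n x y : ℝ≥0∞) := by
  have hm : Measurable fun y => (F.m n x y : ℝ≥0∞) :=
    ((F.m_meas n).comp measurable_prodMk_left).coe_nnreal_ennreal
  change F.g n x • F.M n x = _
  rw [F.M_eq, ENNReal.smul_def, ← withDensity_smul _ hm]
  rfl

lemma Q_univ (n : ℕ) (x : X n) : F.Q n x Set.univ = F.g n x := by
  have := F.M_markov n
  change (F.g n x : ℝ≥0∞) * F.M n x Set.univ = _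
  rw [measure_univ, mul_one]

lemma integral_Q (n : ℕ) (x : X n) (f : X (n + 1) → ℝ) :
    ∫ y, f y ∂F.Q n x = ∫ y, F.q n x y * f y ∂F.ref n := by
  have hq : Measurable fun y => F.q n x y := (F.measurable_q n).comp measurable_prodMk_left
  rw [Q_apply, integral_withDensity_eq_integral_smul hq]
  rfl

lemma integral_bind_Q (n : ℕ) (μ : Measure (X n)) [IsFiniteMeasure μ] {f : X (n + 1) → ℝ}
    (hf : IsBoundedMeasurable f) :
    ∫ y, f y ∂μ.bind (F.Q n) = ∫ x, ∫ y, F.q n x y * f y ∂F.ref n ∂μ := by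
  rw [← Measure.snd_compProd, Measure.snd,
    integral_map measurable_snd.aemeasurable hf.measurable.aestronglyMeasurable,
    Measure.integral_compProd ((hf.comp measurable_snd).integrable _)]
  simp_rw [integral_Q]

section Density

variable {F} {ρ : ℝ} {n : ℕ}

lemma HasComparableDensity.isBoundedMeasurable_q (h : F.HasComparableDensity ρ n) :
    IsBoundedMeasurable fun p : X n × X (n + 1) => (F.q n p.1 p.2 : ℝ) := by
  obtain ⟨a, -, hq⟩ := h
  exact .of_mem_Icc (F.measurable_q n).coe_nnreal_real fun p => hq p.1 p.2

lemma HasComparableDensity.isBoundedMeasurable_q_left (h : F.HasComparableDensity ρ n)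
    (x : X n) : IsBoundedMeasurable fun y => (F.q n x y : ℝ) :=
  h.isBoundedMeasurable_q.comp measurable_prodMk_left

lemma HasComparableDensity.isBoundedMeasurable_q_right (h : F.HasComparableDensity ρ n)
    (y : X (n + 1)) : IsBoundedMeasurable fun x => (F.q n x y : ℝ) :=
  h.isBoundedMeasurable_q.comp measurable_prodMk_right

/-- A density bounded below has finite mass only if the dominating measure is finite. -/
lemma HasComparableDensity.isFiniteMeasure_ref [Nonempty (X n)]
    (h : F.HasComparableDensity ρ n) : IsFiniteMeasure (F.ref n) := by
  obtain ⟨a, ha, hq⟩ := h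
  obtain ⟨x⟩ := ‹Nonempty (X n)›
  have hle : ENNReal.ofReal a * F.ref n Set.univ ≤ F.g n x := by
    rw [← Q_univ, Q_apply, withDensity_apply _ .univ, ← lintegral_const, Measure.restrict_univ]
    refine lintegral_mono fun y => ?_
    rw [← ENNReal.ofReal_coe_nnreal]
    exact ENNReal.ofReal_le_ofReal (hq x y).1
  refine ⟨lt_top_iff_ne_top.2 fun htop => ?_⟩
  rw [htop, ENNReal.mul_top (by simpa using ha)] at hle
  exact absurd hle (by simp)

lemma HasComparableDensity.neZero_ref [Nonempty (X n)] [Nonempty (X (n + 1))]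
    (h : F.HasComparableDensity ρ n) : NeZero (F.ref n) := by
  obtain ⟨a, ha, hq⟩ := h
  obtain ⟨x⟩ := ‹Nonempty (X n)›
  obtain ⟨y⟩ := ‹Nonempty (X (n + 1))›
  refine ⟨fun h0 => ?_⟩
  have h1 := F.Q_univ n x
  rw [Q_apply, h0, withDensity_zero_left, Measure.coe_zero, Pi.zero_apply] at h1
  have h2 : F.g n x = 0 := by exact_mod_cast h1.symm
  have h3 := (hq x y).1
  simp only [q, h2, zero_mul, NNReal.coe_zero] at h3
  linarith

lemma HasComparableDensity.neZero_bind [Nonempty (X n)] [Nonempty (X (n + 1))]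
    (h : F.HasComparableDensity ρ n) (μ : Measure (X n)) [IsFiniteMeasure μ] [NeZero μ] :
    NeZero (μ.bind (F.Q n)) := by
  refine ⟨fun h0 => ?_⟩
  have h1 := F.integral_bind_Q n μ (.const 1)
  have := h.isFiniteMeasure_ref
  have := h.neZero_ref
  have hB := h.isBoundedMeasurable_q.integral_right (F.ref n)
  obtain ⟨a, ha, hq⟩ := id h
  have h2 : 0 < ∫ x, ∫ y, (F.q n x y : ℝ) ∂F.ref n ∂μ :=
    integral_pos_of_pos_le hB (mul_pos ha measureReal_univ_pos) fun x =>
      mul_measureReal_univ_le_integral (h.isBoundedMeasurable_q_left x) fun y => (hq x y).1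
  simp only [h0, integral_zero_measure, mul_one] at h1
  linarith

/-- The weighted means of `μ Q_n` are weighted means of `μ`: the weight is carried back by `Q_n`
and the function is replaced by its mean under the corresponding conditional law. -/
lemma HasComparableDensity.weightedMean_bind [Nonempty (X n)] [Nonempty (X (n + 1))]
    (h : F.HasComparableDensity ρ n) (μ : Measure (X n)) [IsFiniteMeasure μ]
    {w f : X (n + 1) → ℝ} {a : ℝ} (hw : IsBoundedMeasurable w) (ha : 0 < a)
    (haw : ∀ y, a ≤ w y) (hf : IsBoundedMeasurable f) :
    weightedMean (μ.bind (F.Q n)) w f =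
      weightedMean μ (fun x => ∫ y, F.q n x y * w y ∂F.ref n)
        (fun x => weightedMean (F.ref n) (fun y => F.q n x y * w y) f) := by
  have := h.isFiniteMeasure_ref
  have := h.neZero_ref
  obtain ⟨b, hb, hq⟩ := id h
  rw [weightedMean, F.integral_bind_Q n μ (hw.mul hf), F.integral_bind_Q n μ hw, weightedMean]
  congr 2
  ext x
  have hpos : 0 < ∫ y, F.q n x y * w y ∂F.ref n :=
    integral_pos_of_pos_le ((h.isBoundedMeasurable_q_left x).mul hw) (mul_pos hb ha) fun y =>
      mul_le_mul (hq x y).1 (haw y) ha.le (F.q n x y).2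
  rw [weightedMean, mul_div_cancel₀ _ hpos.ne']
  simp_rw [mul_assoc]

end Density

/-! ### Stability of the forward flow -/

/-- The unnormalised marginals `γ_n = η_0 Q_0 ⋯ Q_{n-1}`. -/
noncomputable def unnormMarginal : ∀ n : ℕ, Measure (X n)
  | 0 => F.init
  | n + 1 => (unnormMarginal n).bind (F.Q n)

instance instIsFiniteMeasureUnnormMarginal (n : ℕ) : IsFiniteMeasure (F.unnormMarginal n) := by
  induction n with
  | zero =>
    have := F.init_prob
    exact inferInstanceAs (IsFiniteMeasure F.init)
  | succ n ih => unfold unnormMarginal; infer_instance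

lemma neZero_unnormMarginal [∀ n, Nonempty (X n)] {ρ : ℝ} {n : ℕ}
    (h : ∀ m < n, F.HasComparableDensity ρ m) : NeZero (F.unnormMarginal n) := by
  induction n with
  | zero => exact F.init_prob.neZero
  | succ n ih =>
    have := ih fun m hm => h m (hm.trans n.lt_succ_self)
    exact (h n n.lt_succ_self).neZero_bind _

variable (N : ℕ) (z : ∀ m, X m)

/-- One step of the frozen-path flow is a step of the original flow, followed by moving the
proportion `1 / N` of the mass to the frozen path. -/
lemma frozenUnnorm_succ (n : ℕ) :
    F.frozenUnnorm N z (n + 1) =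
      (1 - (N : ℝ≥0)⁻¹) • (F.frozenUnnorm N z n).bind (F.Q n) +
        ((N : ℝ≥0)⁻¹ * ((F.frozenUnnorm N z n).bind (F.Q n) Set.univ).toNNReal) •
          Measure.dirac (z (n + 1)) := by
  set μ := F.frozenUnnorm N z n
  have hfin : μ.bind (F.Q n) Set.univ ≠ ∞ := measure_ne_top _ _
  ext s hs
  rw [frozenUnnorm, Measure.bind_apply hs (Kernel.aemeasurable _)]
  change ∫⁻ x, (((1 - (N : ℝ≥0)⁻¹ : ℝ≥0) : ℝ≥0∞) * F.Q n x s +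
    (((N : ℝ≥0)⁻¹ * F.g n x : ℝ≥0) : ℝ≥0∞) * Measure.dirac (z (n + 1)) s) ∂μ =
    ((1 - (N : ℝ≥0)⁻¹ : ℝ≥0) : ℝ≥0∞) * μ.bind (F.Q n) s +
    (((N : ℝ≥0)⁻¹ * (μ.bind (F.Q n) Set.univ).toNNReal : ℝ≥0) : ℝ≥0∞) *
      Measure.dirac (z (n + 1)) s
  have hg : Measurable fun x => (F.g n x : ℝ≥0∞) := (F.g_meas n).coe_nnreal_ennreal
  simp only [ENNReal.coe_mul, ENNReal.coe_toNNReal hfin]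
  rw [lintegral_add_left (((F.Q n).measurable_coe hs).const_mul _),
    lintegral_const_mul _ ((F.Q n).measurable_coe hs),
    lintegral_mul_const _ (hg.const_mul _), lintegral_const_mul _ hg,
    Measure.bind_apply hs (Kernel.aemeasurable _),
    Measure.bind_apply .univ (Kernel.aemeasurable _)]
  simp_rw [Q_univ]

variable {N}

lemma neZero_frozenUnnorm [∀ n, Nonempty (X n)] (hN : 1 ≤ N) {ρ : ℝ} {n : ℕ}
    (h : ∀ m < n, F.HasComparableDensity ρ m) : NeZero (F.frozenUnnorm N z n) := by
  have ht : (N : ℝ≥0)⁻¹ ≤ 1 := inv_le_one_of_one_le₀ (by exact_mod_cast hN)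
  induction n with
  | zero =>
    have := F.init_prob
    have := neZero_smul_add_smul_dirac F.init ht (z 0)
    rw [measure_univ, ENNReal.toNNReal_one, mul_one] at this
    exact this
  | succ n ih =>
    have := ih fun m hm => h m (hm.trans n.lt_succ_self)
    have := (h n n.lt_succ_self).neZero_bind (F.frozenUnnorm N z n)
    rw [frozenUnnorm_succ]
    exact neZero_smul_add_smul_dirac _ ht _

/-- **Stability of the forward flow.** Freezing a path moves the weighted means of the time `n`
marginal by `O(1 / N)`, uniformly in `n`. The error made in the last step is at most
`ρ D / N`; the earlier ones are the errors, one step before, for the weight and the function that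
are carried back by `Q_n`, and this multiplies the oscillation of the function by `1 - 1 / ρ`. The
constant `ρ ^ 2` is the sum of the geometric series. -/
theorem abs_weightedMean_frozenUnnorm_sub_le [∀ n, Nonempty (X n)] (hN : 1 ≤ N) {ρ : ℝ}
    (hρ : 1 ≤ ρ) (n : ℕ) (h : ∀ m < n, F.HasComparableDensity ρ m) {w f : X n → ℝ} {a l D : ℝ}
    (hw : Measurable w) (ha : 0 < a) (haw : ∀ x, a ≤ w x ∧ w x ≤ ρ * a) (hf : Measurable f)
    (hl : ∀ x, l ≤ f x ∧ f x ≤ l + D) :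
    |weightedMean (F.frozenUnnorm N z n) w f - weightedMean (F.unnormMarginal n) w f| ≤
      ρ ^ 2 * D * (N : ℝ)⁻¹ := by
  have ht : (N : ℝ≥0)⁻¹ ≤ 1 := inv_le_one_of_one_le₀ (by exact_mod_cast hN)
  have ht0 : (0 : ℝ) ≤ (N : ℝ)⁻¹ := by positivity
  have hρ0 : 0 < ρ := by linarith
  have hD : 0 ≤ D := by linarith [(hl (z n)).1, (hl (z n)).2]
  induction n generalizing a l D with
  | zero =>
    have := F.init_prob
    have := abs_weightedMean_add_dirac_sub_le (μ := F.init) (c := 1) ht hw ha haw hf hl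
      (by simp) (z 0)
    rw [mul_one, NNReal.coe_inv, NNReal.coe_natCast] at this
    refine this.trans ?_
    have : ρ ≤ ρ ^ 2 := by nlinarith
    calc (N : ℝ)⁻¹ * ρ * D = ρ * D * (N : ℝ)⁻¹ := by ring
      _ ≤ _ := by gcongr
  | succ n ih =>
    have hn := h n n.lt_succ_self
    have h' : ∀ m < n, F.HasComparableDensity ρ m := fun m hm => h m (hm.trans n.lt_succ_self)
    have := F.neZero_frozenUnnorm z hN h'
    have := hn.neZero_bind (F.frozenUnnorm N z n)
    have := hn.isFiniteMeasure_ref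
    have := hn.neZero_ref
    have hwB : IsBoundedMeasurable w := .of_mem_Icc hw haw
    have hfB : IsBoundedMeasurable f := .of_mem_Icc hf hl
    have e := fun μ [IsFiniteMeasure μ] => hn.weightedMean_bind μ hwB ha (fun y => (haw y).1) hfB
    -- the error made in the last step
    have h1 := abs_weightedMean_add_dirac_sub_le (μ := (F.frozenUnnorm N z n).bind (F.Q n))
      (c := ((F.frozenUnnorm N z n).bind (F.Q n) Set.univ).toNNReal) ht hw ha haw hf hl rfl
      (z (n + 1))
    rw [← frozenUnnorm_succ, NNReal.coe_inv, NNReal.coe_natCast] at h1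
    obtain ⟨b, hb, hq⟩ := id hn
    have hqw : IsBoundedMeasurable fun p : X n × X (n + 1) => F.q n p.1 p.2 * w p.2 :=
      hn.isBoundedMeasurable_q.mul (hwB.comp measurable_snd)
    have hqwf : IsBoundedMeasurable fun p : X n × X (n + 1) => F.q n p.1 p.2 * w p.2 * f p.2 :=
      hqw.mul (hfB.comp measurable_snd)
    have hW : 0 < ∫ y, w y ∂F.ref n := integral_pos_of_pos_le hwB ha fun y => (haw y).1
    have hqW : ∀ x y, b * w y ≤ F.q n x y * w y ∧ F.q n x y * w y ≤ ρ * b * w y := fun x y =>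
      have hw0 := ha.le.trans (haw y).1
      ⟨mul_le_mul_of_nonneg_right (hq x y).1 hw0, mul_le_mul_of_nonneg_right (hq x y).2 hw0⟩
    -- the errors made earlier
    have h2 := ih h' (w := fun x => ∫ y, F.q n x y * w y ∂F.ref n)
      (f := fun x => weightedMean (F.ref n) (fun y => F.q n x y * w y) f)
      (a := b * ∫ y, w y ∂F.ref n) (D := (1 - ρ⁻¹) * D)
      (hqw.integral_right (F.ref n)).measurable (mul_pos hb hW)
      (fun x => by
        have hi := (hqw.comp (measurable_prodMk_left (x := x))).integrable (F.ref n)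
        constructor
        · rw [← integral_const_mul]
          exact integral_mono ((hwB.integrable _).const_mul _) hi fun y => (hqW x y).1
        · rw [← mul_assoc, ← integral_const_mul]
          exact integral_mono hi ((hwB.integrable _).const_mul _) fun y => (hqW x y).2)
      ((hqwf.integral_right (F.ref n)).measurable.div
        (hqw.integral_right (F.ref n)).measurable)
      (fun x => weightedMean_mem_contracted hρ hwB ha (fun y => (haw y).1) hb
        (hqw.comp (measurable_prodMk_left (x := x))).measurable (hqW x) hf hl)
      (mul_nonneg (sub_nonneg.2 (inv_le_one_of_one_le₀ hρ)) hD)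
    rw [← e, ← e] at h2
    refine (abs_sub_le _ _ _).trans ((add_le_add h1 h2).trans_eq ?_)
    field_simp
    ring

end FeynmanKac

namespace FeynmanKac

variable {X : ℕ → Type u} [∀ n, MeasurableSpace (X n)] (F : FeynmanKac X)

/-! ### The backward recursion -/

/-- The conditional expectation of the additive functional `h_n` given `x_n = y`, when the path
is drawn backwards from `y` by the kernels `B_{m,μ_m}`. The measures `μ_m` need not be
normalised. -/
noncomputable def backwardMean (μ : ∀ n, Measure (X n)) (h : ∀ m, X m × X (m + 1) → ℝ) :
    ∀ n, X n → ℝ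
  | 0 => fun _ => 0
  | n + 1 => fun y =>
    weightedMean (μ n) (fun x => F.q n x y) fun x => backwardMean μ h n x + h n (x, y)

variable {F} {ρ : ℝ} {n : ℕ} {h : ∀ m, X m × X (m + 1) → ℝ} (μ : ∀ n, Measure (X n))

lemma backwardMean_succ (y : X (n + 1)) :
    F.backwardMean μ h (n + 1) y =
      weightedMean (μ n) (fun x => F.q n x y) fun x => F.backwardMean μ h n x + h n (x, y) :=
  rfl

lemma isBoundedMeasurable_backwardMean [∀ n, IsFiniteMeasure (μ n)]
    (hq : ∀ m < n, F.HasComparableDensity ρ m) (hμ : ∀ m < n, NeZero (μ m))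
    (hh : ∀ m, IsBoundedMeasurable (h m)) : IsBoundedMeasurable (F.backwardMean μ h n) := by
  induction n with
  | zero => exact .const 0
  | succ n ih =>
    have ih := ih (fun m hm => hq m (hm.trans n.lt_succ_self))
      fun m hm => hμ m (hm.trans n.lt_succ_self)
    have hn := hq n n.lt_succ_self
    have := hμ n n.lt_succ_self
    have hf : IsBoundedMeasurable fun p : X n × X (n + 1) => F.backwardMean μ h n p.1 + h n p :=
      (ih.comp measurable_fst).add (hh n)
    refine ⟨((hn.isBoundedMeasurable_q.mul hf).integral_left (μ n)).measurable.div
      (hn.isBoundedMeasurable_q.integral_left (μ n)).measurable, ?_⟩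
    obtain ⟨C, hC⟩ := hf.bounded
    obtain ⟨a, ha, haq⟩ := id hn
    exact ⟨C, fun y => abs_weightedMean_le (hn.isBoundedMeasurable_q_right y) ha
      (fun x => (haq x y).1) (hf.measurable.comp measurable_prodMk_right) fun x => hC (x, y)⟩

/-- Integration against the density of the conditional expectation: multiplying the weighted mean
by its total weight gives back the integral. -/
lemma integral_q_mul_backwardMean [∀ n, IsFiniteMeasure (μ n)] [NeZero (μ n)]
    (hn : F.HasComparableDensity ρ n) (y : X (n + 1)) :
    (∫ x, (F.q n x y : ℝ) ∂μ n) * F.backwardMean μ h (n + 1) y =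
      ∫ x, F.q n x y * (F.backwardMean μ h n x + h n (x, y)) ∂μ n := by
  obtain ⟨a, ha, haq⟩ := id hn
  have : 0 < ∫ x, (F.q n x y : ℝ) ∂μ n :=
    integral_pos_of_pos_le (hn.isBoundedMeasurable_q_right y) ha fun x => (haq x y).1
  rw [backwardMean_succ, weightedMean, mul_div_cancel₀ _ this.ne']

/-- Comparison of the backward recursions of the frozen-path flow and of the original one. With
`O` the oscillation of the original conditional expectation and `D` the distance between the two,
one step gives `O' = (1 - 1 / ρ) O + 2 ‖h_n‖` by contraction and
`D' = D + (ρ ^ 2 / N) (O + 2 ‖h_n‖)` by stability of the forward flow, the backward kernels being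
weighted means of the marginals. The combination `D + (ρ ^ 3 / N) O` grows by a multiple of
`‖h_n‖` only. -/
theorem exists_backwardMean_frozenUnnorm_close [∀ n, Nonempty (X n)] (z : ∀ m, X m) {N : ℕ}
    (hN : 1 ≤ N) (hρ : 1 ≤ ρ) (n : ℕ) (hq : ∀ m < n, F.HasComparableDensity ρ m)
    (hh : ∀ m, Measurable (h m)) {H : ℕ → ℝ} (hH : ∀ m p, |h m p| ≤ H m) :
    ∃ l O D : ℝ,
      (∀ x, l ≤ F.backwardMean F.unnormMarginal h n x ∧
        F.backwardMean F.unnormMarginal h n x ≤ l + O) ∧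
      (∀ x, |F.backwardMean (F.frozenUnnorm N z) h n x -
        F.backwardMean F.unnormMarginal h n x| ≤ D) ∧
      D + ρ ^ 3 * (N : ℝ)⁻¹ * O ≤
        (2 * ρ ^ 2 + 2 * ρ ^ 3) * (N : ℝ)⁻¹ * ∑ m ∈ Finset.range n, H m := by
  have hhB : ∀ m, IsBoundedMeasurable (h m) := fun m => ⟨hh m, H m, hH m⟩
  induction n with
  | zero => exact ⟨0, 0, 0, by simp [backwardMean]⟩
  | succ n ih =>
    have hq' : ∀ m < n, F.HasComparableDensity ρ m := fun m hm =>
      hq m (hm.trans n.lt_succ_self)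
    have hn := hq n n.lt_succ_self
    obtain ⟨l, O, D, hO, hD, hsum⟩ := ih hq'
    have hz : ∀ m ≤ n, NeZero (F.frozenUnnorm N z m) := fun m hm =>
      F.neZero_frozenUnnorm z hN fun k hk => hq' k (hk.trans_le hm)
    have hu : ∀ m ≤ n, NeZero (F.unnormMarginal m) := fun m hm =>
      F.neZero_unnormMarginal fun k hk => hq' k (hk.trans_le hm)
    have := hz n le_rfl
    have := hu n le_rfl
    have hSz : IsBoundedMeasurable (F.backwardMean (F.frozenUnnorm N z) h n) :=
      isBoundedMeasurable_backwardMean _ hq' (fun m hm => hz m hm.le) hhB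
    have hS : IsBoundedMeasurable (F.backwardMean F.unnormMarginal h n) :=
      isBoundedMeasurable_backwardMean _ hq' (fun m hm => hu m hm.le) hhB
    obtain ⟨a, ha, haq⟩ := id hn
    have hhy : ∀ y, IsBoundedMeasurable fun x => h n (x, y) := fun y =>
      (hhB n).comp measurable_prodMk_right
    have hw : ∀ y, IsBoundedMeasurable fun x => (F.q n x y : ℝ) := hn.isBoundedMeasurable_q_right
    have hN0 : 0 < (N : ℝ)⁻¹ := by positivity
    have hρ0 : 0 < ρ := by linarith
    set c := ρ⁻¹ * weightedMean (F.unnormMarginal n) (fun _ => 1)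
      (F.backwardMean F.unnormMarginal h n) + (1 - ρ⁻¹) * l
    refine ⟨c - H n, (1 - ρ⁻¹) * O + 2 * H n, D + ρ ^ 2 * (O + 2 * H n) * (N : ℝ)⁻¹,
      fun y => ?_, fun y => ?_, ?_⟩
    · have h1 := weightedMean_mem_contracted (μ := F.unnormMarginal n) hρ
        (.const 1) one_pos (fun _ => le_rfl) ha (hw y).measurable
        (fun x => by simpa only [mul_one] using haq x y) hS.measurable hO
      have h2 := weightedMean_mem (μ := F.unnormMarginal n) (hw y) ha (fun x => (haq x y).1)
        (hhy y).measurable fun x => abs_le.1 (hH n (x, y))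
      rw [backwardMean_succ, weightedMean_add (hw y) hS (hhy y)]
      constructor <;> linarith [h1.1, h1.2, h2.1, h2.2]
    · have h1 := abs_weightedMean_le (μ := F.frozenUnnorm N z n) (hw y) ha
        (fun x => (haq x y).1) (hSz.sub hS).measurable hD
      have h2 := F.abs_weightedMean_frozenUnnorm_sub_le z hN hρ n hq' (hw y).measurable ha
        (fun x => haq x y) (hS.add (hhy y)).measurable (l := l - H n) (D := O + 2 * H n)
        fun x => by
          have := abs_le.1 (hH n (x, y))
          constructor <;> linarith [(hO x).1, (hO x).2, this.1, this.2]
      have e : F.backwardMean (F.frozenUnnorm N z) h (n + 1) y -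
          F.backwardMean F.unnormMarginal h (n + 1) y =
          weightedMean (F.frozenUnnorm N z n) (fun x => F.q n x y)
            (fun x => F.backwardMean (F.frozenUnnorm N z) h n x -
              F.backwardMean F.unnormMarginal h n x) +
          (weightedMean (F.frozenUnnorm N z n) (fun x => F.q n x y)
            (fun x => F.backwardMean F.unnormMarginal h n x + h n (x, y)) -
          weightedMean (F.unnormMarginal n) (fun x => F.q n x y)
            (fun x => F.backwardMean F.unnormMarginal h n x + h n (x, y))) := by
        rw [backwardMean_succ, backwardMean_succ, weightedMean_add (hw y) hSz (hhy y),
          weightedMean_add (hw y) hS (hhy y), weightedMean_sub (hw y) hSz hS,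
          weightedMean_add (hw y) hS (hhy y)]
        ring
      rw [e]
      exact (abs_add_le _ _).trans (add_le_add h1 h2)
    · rw [Finset.sum_range_succ, mul_add _ (∑ m ∈ Finset.range n, H m)]
      have e : D + ρ ^ 2 * (O + 2 * H n) * (N : ℝ)⁻¹ +
          ρ ^ 3 * (N : ℝ)⁻¹ * ((1 - ρ⁻¹) * O + 2 * H n) =
          D + ρ ^ 3 * (N : ℝ)⁻¹ * O + (2 * ρ ^ 2 + 2 * ρ ^ 3) * (N : ℝ)⁻¹ * H n := by
        field_simp
        ring
      rw [e]
      gcongr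

/-! ### Path measures and the backward recursion -/

lemma appendState_castSucc {Y : ℕ → Type u} (n : ℕ) (p : (∀ i : Fin n, Y i) × Y n)
    (i : Fin n) : appendState Y n p i.castSucc = p.1 i :=
  Fin.snoc_castSucc (α := fun i : Fin (n + 1) => Y i) p.2 p.1 i

lemma appendState_last {Y : ℕ → Type u} (n : ℕ) (p : (∀ i : Fin n, Y i) × Y n) :
    appendState Y n p (Fin.last n) = p.2 :=
  Fin.snoc_last (α := fun i : Fin (n + 1) => Y i) p.2 p.1

lemma measurable_appendState (n : ℕ) : Measurable (appendState X n) := by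
  refine measurable_pi_lambda _ fun i => ?_
  induction i using Fin.lastCases with
  | last =>
    simp_rw [appendState_last]
    exact measurable_snd
  | cast i =>
    simp_rw [appendState_castSucc]
    exact (measurable_pi_apply i).comp measurable_fst

lemma additiveFunctional_appendState {Y : ℕ → Type u} (h : ∀ m, Y m × Y (m + 1) → ℝ) (n : ℕ)
    (p : ∀ i : Fin (n + 1), Y i) (y : Y (n + 1)) :
    additiveFunctional h (n + 1) (appendState Y (n + 1) (p, y)) =
      additiveFunctional h n p + h n (p (Fin.last n), y) := by
  unfold additiveFunctional
  rw [Fin.sum_univ_castSucc]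
  congr 1
  · refine Finset.sum_congr rfl fun m _ => ?_
    have h1 := appendState_castSucc (n + 1) (p, y) m.castSucc
    have h2 := appendState_castSucc (n + 1) (p, y) m.succ
    exact congrArg (h m) (Prod.ext h1 h2)
  · have h1 := appendState_castSucc (n + 1) (p, y) (Fin.last n)
    have h2 := appendState_last (n + 1) (p, y)
    exact congrArg (h n) (Prod.ext h1 h2)

lemma isBoundedMeasurable_additiveFunctional (hh : ∀ m, IsBoundedMeasurable (h m)) (n : ℕ) :
    IsBoundedMeasurable (additiveFunctional h n) := by
  choose C hC using fun m => (hh m).bounded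
  refine ⟨Finset.measurable_sum _ fun m _ => (hh m).measurable.comp
    ((measurable_pi_apply m.castSucc).prodMk (measurable_pi_apply m.succ)),
    ∑ m : Fin n, C m, fun x => ?_⟩
  exact (Finset.abs_sum_le_sum_abs _ _).trans (Finset.sum_le_sum fun m _ => hC m _)

instance instIsFiniteMeasureUnnormPath (n : ℕ) : IsFiniteMeasure (F.unnormPath n) := by
  have := F.init_prob
  induction n with
  | zero => unfold unnormPath; infer_instance
  | succ n ih => unfold unnormPath; infer_instance

lemma integral_unnormPath_succ {f : (∀ i : Fin (n + 2), X i) → ℝ} (hf : IsBoundedMeasurable f) :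
    ∫ x, f x ∂F.unnormPath (n + 1) =
      ∫ p, ∫ y, F.q n (p (Fin.last n)) y * f (appendState X (n + 1) (p, y)) ∂F.ref n
        ∂F.unnormPath n := by
  rw [unnormPath, integral_map (measurable_appendState _).aemeasurable
      hf.measurable.aestronglyMeasurable,
    Measure.integral_compProd ((hf.comp (measurable_appendState _)).integrable _)]
  simp_rw [Kernel.comap_apply, integral_Q]

/-- The last coordinate of the path has the unnormalised marginal as its law. -/
lemma integral_unnormPath_last (n : ℕ) {f : X n → ℝ} (hf : IsBoundedMeasurable f)
    (hq : ∀ m < n, F.HasComparableDensity ρ m) [∀ n, Nonempty (X n)] :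
    ∫ x, f (x (Fin.last n)) ∂F.unnormPath n = ∫ x, f x ∂F.unnormMarginal n := by
  induction n with
  | zero =>
    rw [unnormPath, integral_map ?_ ?_]
    · rfl
    · exact ((measurable_appendState 0).comp (measurable_const.prodMk measurable_id)).aemeasurable
    · exact (hf.measurable.comp (measurable_pi_apply (Fin.last 0))).aestronglyMeasurable
  | succ n ih =>
    have hn := hq n n.lt_succ_self
    have := hn.isFiniteMeasure_ref
    rw [integral_unnormPath_succ (hf.comp (measurable_pi_apply _)), unnormMarginal,
      F.integral_bind_Q n _ hf]
    simp_rw [appendState_last]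
    exact ih (f := fun x => ∫ y, F.q n x y * f y ∂F.ref n)
      ((hn.isBoundedMeasurable_q.mul (hf.comp measurable_snd)).integral_right (F.ref n))
      fun m hm => hq m (hm.trans n.lt_succ_self)

/-- The backward representation of the path measure: under `γ_{0:n}`, the backward recursion gives
the conditional expectation of the additive functional given the last coordinate. -/
theorem integral_additiveFunctional_mul_unnormPath [∀ n, Nonempty (X n)] (n : ℕ)
    (hq : ∀ m < n, F.HasComparableDensity ρ m) (hh : ∀ m, IsBoundedMeasurable (h m))
    {f : X n → ℝ} (hf : IsBoundedMeasurable f) :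
    ∫ x, additiveFunctional h n x * f (x (Fin.last n)) ∂F.unnormPath n =
      ∫ x, F.backwardMean F.unnormMarginal h n x * f x ∂F.unnormMarginal n := by
  induction n with
  | zero => simp [additiveFunctional, backwardMean]
  | succ n ih =>
    have hq' : ∀ m < n, F.HasComparableDensity ρ m := fun m hm =>
      hq m (hm.trans n.lt_succ_self)
    have hn := hq n n.lt_succ_self
    have := hn.isFiniteMeasure_ref
    have hu : ∀ m < n + 1, NeZero (F.unnormMarginal m) := fun m hm =>
      F.neZero_unnormMarginal fun k hk => hq k (hk.trans hm)
    have := hu n n.lt_succ_self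
    have hS : IsBoundedMeasurable (F.backwardMean F.unnormMarginal h n) :=
      isBoundedMeasurable_backwardMean _ hq' (fun m hm => hu m (hm.trans n.lt_succ_self)) hh
    have hS' : IsBoundedMeasurable (F.backwardMean F.unnormMarginal h (n + 1)) :=
      isBoundedMeasurable_backwardMean _ hq hu hh
    have hqf : IsBoundedMeasurable fun p : X n × X (n + 1) => F.q n p.1 p.2 * f p.2 :=
      hn.isBoundedMeasurable_q.mul (hf.comp measurable_snd)
    have hqfh : IsBoundedMeasurable fun p : X n × X (n + 1) => F.q n p.1 p.2 * f p.2 * h n p :=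
      hqf.mul (hh n)
    have hk := hqf.integral_right (F.ref n)
    have hkh := hqfh.integral_right (F.ref n)
    have hlast : Measurable fun p : ∀ i : Fin (n + 1), X i => p (Fin.last n) :=
      measurable_pi_apply _
    have split : ∀ (s : ℝ) (x : X n), ∫ y, F.q n x y * ((s + h n (x, y)) * f y) ∂F.ref n =
        s * (∫ y, F.q n x y * f y ∂F.ref n) + ∫ y, F.q n x y * f y * h n (x, y) ∂F.ref n := by
      intro s x
      rw [← integral_const_mul, ← integral_add]
      · exact integral_congr_ae (ae_of_all _ fun y => by ring)
      · exact ((hqf.comp (measurable_prodMk_left (x := x))).integrable _).const_mul _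
      · exact (hqfh.comp (measurable_prodMk_left (x := x))).integrable _
    rw [integral_unnormPath_succ ((isBoundedMeasurable_additiveFunctional hh _).mul
      (hf.comp (measurable_pi_apply _))), unnormMarginal, F.integral_bind_Q n _ (hS'.mul hf)]
    simp_rw [appendState_last, additiveFunctional_appendState, split]
    rw [integral_add (((isBoundedMeasurable_additiveFunctional hh n).mul
        (hk.comp hlast)).integrable _) ((hkh.comp hlast).integrable _),
      ih hq' hk, F.integral_unnormPath_last n hkh hq',
      ← integral_add ((hS.mul hk).integrable _) (hkh.integrable _)]
    simp_rw [← split]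
    -- exchanging the integrals turns both sides into integrals over the last state
    refine (integral_integral_swap ?_).trans (Eq.trans ?_ (integral_integral_swap ?_).symm)
    · exact (hn.isBoundedMeasurable_q.mul (((hS.comp measurable_fst).add (hh n)).mul
        (hf.comp measurable_snd))).integrable _
    · refine integral_congr_ae (ae_of_all _ fun y => ?_)
      have e := integral_q_mul_backwardMean (h := h) F.unnormMarginal hn y
      calc ∫ x, F.q n x y * ((F.backwardMean F.unnormMarginal h n x + h n (x, y)) * f y)
            ∂F.unnormMarginal n
          = (∫ x, F.q n x y * (F.backwardMean F.unnormMarginal h n x + h n (x, y))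
            ∂F.unnormMarginal n) * f y := by
            rw [← integral_mul_const]
            simp_rw [mul_assoc]
        _ = (∫ x, (F.q n x y : ℝ) ∂F.unnormMarginal n) *
            (F.backwardMean F.unnormMarginal h (n + 1) y * f y) := by rw [← e, mul_assoc]
        _ = _ := (integral_mul_const _ _).symm
    · exact (hn.isBoundedMeasurable_q.mul ((hS'.mul hf).comp measurable_snd)).integrable _

lemma integral_additiveFunctional_path [∀ n, Nonempty (X n)] (n : ℕ)
    (hq : ∀ m < n, F.HasComparableDensity ρ m) (hh : ∀ m, IsBoundedMeasurable (h m)) :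
    ∫ x, additiveFunctional h n x ∂F.path n =
      weightedMean (F.unnormMarginal n) (fun _ => 1)
        (F.backwardMean F.unnormMarginal h n) := by
  have h1 := integral_additiveFunctional_mul_unnormPath n hq hh (.const 1)
  have h2 := F.integral_unnormPath_last n (.const 1) hq
  simp only [mul_one] at h1
  rw [path, integral_smul_measure, h1, weightedMean, ← h2]
  simp [measureReal_def, div_eq_inv_mul]

/-! ### The backward kernels -/

lemma backward_apply (F : FeynmanKac X) (η : Measure (X n)) [SFinite η] (y : X (n + 1)) :
    F.backward n η y =
      η.withDensity fun x => (F.q n x y : ℝ≥0∞) / ∫⁻ x', (F.q n x' y : ℝ≥0∞) ∂η := by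
  have hq : Measurable fun p : X (n + 1) × X n => (F.q n p.2 p.1 : ℝ≥0∞) :=
    ((F.measurable_q n).comp measurable_swap).coe_nnreal_ennreal
  rw [backward, Kernel.withDensity_apply, Kernel.const_apply]
  exact hq.div ((hq.lintegral_prod_right' (ν := η)).comp measurable_fst)

section Backward

variable {η : Measure (X n)} [IsFiniteMeasure η] [NeZero η]

lemma HasComparableDensity.lintegral_q (hn : F.HasComparableDensity ρ n) (y : X (n + 1)) :
    ∫⁻ x, (F.q n x y : ℝ≥0∞) ∂η ≠ 0 ∧ ∫⁻ x, (F.q n x y : ℝ≥0∞) ∂η ≠ ∞ := by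
  have hi := (hn.isBoundedMeasurable_q_right y).integrable η
  obtain ⟨a, ha, haq⟩ := id hn
  have hpos : 0 < ∫ x, (F.q n x y : ℝ) ∂η :=
    integral_pos_of_pos_le (hn.isBoundedMeasurable_q_right y) ha fun x => (haq x y).1
  have e : ENNReal.ofReal (∫ x, (F.q n x y : ℝ) ∂η) = ∫⁻ x, (F.q n x y : ℝ≥0∞) ∂η := by
    rw [ofReal_integral_eq_lintegral_ofReal hi (ae_of_all _ fun x => (F.q n x y).2)]
    simp_rw [ENNReal.ofReal_coe_nnreal]
  rw [← e]
  exact ⟨by simpa using hpos, ENNReal.ofReal_ne_top⟩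

lemma HasComparableDensity.isMarkovKernel_backward (hn : F.HasComparableDensity ρ n) :
    IsMarkovKernel (F.backward n η) := by
  refine ⟨fun y => ⟨?_⟩⟩
  have hq : Measurable fun x => (F.q n x y : ℝ≥0∞) :=
    ((F.measurable_q n).comp measurable_prodMk_right).coe_nnreal_ennreal
  obtain ⟨h0, htop⟩ := hn.lintegral_q (η := η) y
  rw [backward_apply, withDensity_apply _ .univ, Measure.restrict_univ]
  simp_rw [div_eq_mul_inv]
  rw [lintegral_mul_const _ hq, ENNReal.mul_inv_cancel h0 htop]

/-- The backward kernels are weighted means, with the densities `q_n(·, y)` as weights. -/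
lemma HasComparableDensity.integral_backward (hn : F.HasComparableDensity ρ n)
    (y : X (n + 1)) (f : X n → ℝ) :
    ∫ x, f x ∂F.backward n η y = weightedMean η (fun x => F.q n x y) f := by
  have hq : Measurable fun x => F.q n x y := (F.measurable_q n).comp measurable_prodMk_right
  obtain ⟨h0, htop⟩ := hn.lintegral_q (η := η) y
  set d := ∫⁻ x, (F.q n x y : ℝ≥0∞) ∂η with hd
  have hd' : d.toNNReal ≠ 0 := (ENNReal.toNNReal_ne_zero).2 ⟨h0, htop⟩
  have hdR : ∫ x, (F.q n x y : ℝ) ∂η = d.toNNReal := by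
    rw [integral_eq_lintegral_of_nonneg_ae (f := fun x => (F.q n x y : ℝ))
      (ae_of_all _ fun x => (F.q n x y).2)
      hq.coe_nnreal_real.aestronglyMeasurable]
    simp_rw [ENNReal.ofReal_coe_nnreal]
    rfl
  have e : (fun x => (F.q n x y : ℝ≥0∞) / d) =
      fun x => ((F.q n x y / d.toNNReal : ℝ≥0) : ℝ≥0∞) := by
    ext x
    rw [ENNReal.coe_div hd', ENNReal.coe_toNNReal htop]
  rw [backward_apply, ← hd, e, integral_withDensity_eq_integral_smul (hq.div_const _),
    weightedMean, hdR, ← integral_div]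
  refine integral_congr_ae (ae_of_all _ fun x => ?_)
  simp only [NNReal.smul_def, NNReal.coe_div, smul_eq_mul]
  ring

end Backward

variable (z : ∀ m, X m) {N : ℕ}

lemma isProbabilityMeasure_frozenMarginal [NeZero (F.frozenUnnorm N z n)] :
    IsProbabilityMeasure (F.frozenMarginal N z n) :=
  ⟨ENNReal.inv_mul_cancel (by simp [NeZero.ne]) (measure_ne_top _ _)⟩

lemma weightedMean_frozenMarginal [NeZero (F.frozenUnnorm N z n)] (w f : X n → ℝ) :
    weightedMean (F.frozenMarginal N z n) w f = weightedMean (F.frozenUnnorm N z n) w f :=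
  weightedMean_smul_measure (by simp) (by simp [NeZero.ne]) w f

/-- The kernels `R^z_n` are Markov kernels, and they integrate the additive functional to the
backward recursion of the frozen-path flow. -/
theorem frozenR_spec [∀ n, Nonempty (X n)] (hN : 1 ≤ N) (n : ℕ)
    (hq : ∀ m < n, F.HasComparableDensity ρ m) (hh : ∀ m, IsBoundedMeasurable (h m)) :
    IsMarkovKernel (F.frozenR N z n) ∧
      ∀ x, ∫ p, additiveFunctional h n (appendState X n (p, x)) ∂F.frozenR N z n x =
        F.backwardMean (F.frozenUnnorm N z) h n x := by
  induction n with
  | zero =>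
    refine ⟨?_, fun x => by simp [additiveFunctional, backwardMean]⟩
    unfold frozenR
    infer_instance
  | succ n ih =>
    have hq' : ∀ m < n, F.HasComparableDensity ρ m := fun m hm =>
      hq m (hm.trans n.lt_succ_self)
    have hn := hq n n.lt_succ_self
    obtain ⟨hR, ih⟩ := ih hq'
    have hz := F.neZero_frozenUnnorm z hN hq'
    have := isProbabilityMeasure_frozenMarginal (F := F) (n := n) z (N := N)
    have := hn.isMarkovKernel_backward (η := F.frozenMarginal N z n)
    have hφ : Measurable fun p : X n × (∀ i : Fin n, X i) => appendState X n (p.2, p.1) :=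
      (measurable_appendState n).comp measurable_swap
    refine ⟨?_, fun y => ?_⟩
    · rw [frozenR]
      exact Kernel.IsMarkovKernel.map _ hφ
    · have hA := isBoundedMeasurable_additiveFunctional hh
      have hAy : IsBoundedMeasurable fun p : ∀ i : Fin (n + 1), X i =>
          additiveFunctional h (n + 1) (appendState X (n + 1) (p, y)) :=
        (hA (n + 1)).comp ((measurable_appendState _).comp measurable_prodMk_right)
      rw [frozenR, Kernel.map_apply _ hφ,
        integral_map hφ.aemeasurable hAy.measurable.aestronglyMeasurable,
        ProbabilityTheory.integral_compProd ((hAy.comp hφ).integrable _), backwardMean_succ,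
        ← weightedMean_frozenMarginal, ← hn.integral_backward]
      refine integral_congr_ae (ae_of_all _ fun x => ?_)
      simp only [additiveFunctional_appendState, appendState_last, Kernel.prodMkLeft_apply]
      have hAx : IsBoundedMeasurable fun p : ∀ i : Fin n, X i =>
          additiveFunctional h n (appendState X n (p, x)) :=
        (hA n).comp ((measurable_appendState n).comp measurable_prodMk_right)
      rw [integral_add (hAx.integrable _) (integrable_const _), ih]
      simp

lemma integral_additiveFunctional_frozenPath [∀ n, Nonempty (X n)] (hN : 1 ≤ N) (n : ℕ)
    (hq : ∀ m < n, F.HasComparableDensity ρ m) (hh : ∀ m, IsBoundedMeasurable (h m)) :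
    ∫ x, additiveFunctional h n x ∂F.frozenPath N z n =
      weightedMean (F.frozenUnnorm N z n) (fun _ => 1)
        (F.backwardMean (F.frozenUnnorm N z) h n) := by
  have hz := F.neZero_frozenUnnorm z hN hq
  have := isProbabilityMeasure_frozenMarginal (F := F) (n := n) z (N := N)
  obtain ⟨hR, hint⟩ := frozenR_spec z hN n hq hh
  have hA := isBoundedMeasurable_additiveFunctional hh n
  have hφ : Measurable fun p : X n × (∀ i : Fin n, X i) => appendState X n (p.2, p.1) :=
    (measurable_appendState n).comp measurable_swap
  rw [frozenPath, integral_map hφ.aemeasurable hA.measurable.aestronglyMeasurable,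
    Measure.integral_compProd ((hA.comp hφ).integrable _)]
  simp_rw [hint]
  rw [← weightedMean_frozenMarginal, weightedMean]
  simp

/-! ### Comparison of the path measures -/

/-- The comparison of the two path measures, for a model whose densities are comparable up to a
factor `ρ`. -/
theorem abs_integral_frozenPath_sub_le [∀ n, Nonempty (X n)] (hN : 1 ≤ N) (hρ : 1 ≤ ρ) (n : ℕ)
    (hq : ∀ m < n, F.HasComparableDensity ρ m)
    (hh : ∀ m, Measurable (h m)) {H : ℕ → ℝ} (hH : ∀ m p, |h m p| ≤ H m) :
    |∫ x, additiveFunctional h n x ∂F.frozenPath N z n -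
        ∫ x, additiveFunctional h n x ∂F.path n| ≤
      (2 * ρ ^ 2 + 2 * ρ ^ 3) * (N : ℝ)⁻¹ * ∑ m ∈ Finset.range n, H m := by
  have hhB : ∀ m, IsBoundedMeasurable (h m) := fun m => ⟨hh m, H m, hH m⟩
  have hz : ∀ m ≤ n, NeZero (F.frozenUnnorm N z m) := fun m hm =>
    F.neZero_frozenUnnorm z hN fun k hk => hq k (hk.trans_le hm)
  have hu : ∀ m ≤ n, NeZero (F.unnormMarginal m) := fun m hm =>
    F.neZero_unnormMarginal fun k hk => hq k (hk.trans_le hm)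
  have := hz n le_rfl
  have hSz : IsBoundedMeasurable (F.backwardMean (F.frozenUnnorm N z) h n) :=
    isBoundedMeasurable_backwardMean _ hq (fun m hm => hz m hm.le) hhB
  have hS : IsBoundedMeasurable (F.backwardMean F.unnormMarginal h n) :=
    isBoundedMeasurable_backwardMean _ hq (fun m hm => hu m hm.le) hhB
  obtain ⟨l, O, D, hO, hD, hsum⟩ := exists_backwardMean_frozenUnnorm_close z hN hρ n hq hh hH
  rw [integral_additiveFunctional_frozenPath z hN n hq hhB,
    integral_additiveFunctional_path n hq hhB]
  have h1 := abs_weightedMean_le (μ := F.frozenUnnorm N z n) (.const 1) one_pos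
    (fun _ => le_rfl) (hSz.sub hS).measurable hD
  rw [weightedMean_sub (.const 1) hSz hS] at h1
  have h2 := F.abs_weightedMean_frozenUnnorm_sub_le z hN hρ n hq (w := fun _ => 1)
    measurable_const one_pos (fun _ => ⟨le_rfl, by linarith⟩) hS.measurable hO
  have hO0 : 0 ≤ O := by linarith [(hO (z n)).1, (hO (z n)).2]
  have h3 : ρ ^ 2 * O * (N : ℝ)⁻¹ ≤ ρ ^ 3 * (N : ℝ)⁻¹ * O := by
    rw [mul_right_comm]
    gcongr
    norm_num
  exact (abs_sub_le _ _ _).trans ((add_le_add h1 h2).trans ((add_le_add le_rfl h3).trans hsum))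

end FeynmanKac

theorem mainTheorem8 (ρ : ℝ) :
    ∃ c : ℝ, 0 < c ∧
      ∀ (X : ℕ → Type u) [∀ n, MeasurableSpace (X n)] (F : FeynmanKac X)
        (gLow gHigh mLow mHigh : ℕ → ℝ), F.StrongMixing gLow gHigh mLow mHigh →
      ∀ n : ℕ, mixingRatio gLow gHigh mLow mHigh n ≤ ρ →
      ∀ (N : ℕ), 1 ≤ N → ∀ (z : ∀ m, X m) (h : ∀ m, X m × X (m + 1) → ℝ),
        (∀ m, Measurable (h m)) → (∀ m, ∃ C : ℝ, ∀ p, |h m p| ≤ C) →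
        |∫ x, additiveFunctional h n x ∂(F.frozenPath N z n)
            - ∫ x, additiveFunctional h n x ∂(F.path n)|
          ≤ c * (N : ℝ)⁻¹ * ∑ m ∈ Finset.range n, supNorm (h m) := by
  -- a factor `ρ < 1` cannot occur, and replacing `ρ` by `max ρ 1` makes the constant positive
  have hρ : 1 ≤ max ρ 1 := le_max_right _ _
  have hρ0 : 0 < max ρ 1 := by linarith
  refine ⟨2 * max ρ 1 ^ 2 + 2 * max ρ 1 ^ 3, by positivity, ?_⟩
  intro X _ F gLow gHigh mLow mHigh hF n hn N hN z h hh hb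
  have : ∀ n, Nonempty (X n) := fun n => ⟨z n⟩
  refine FeynmanKac.abs_integral_frozenPath_sub_le z hN hρ n
    (fun m hm => (hF.hasComparableDensity hn hm.le).mono (le_max_left _ _)) hh fun m p => ?_
  obtain ⟨C, hC⟩ := hb m
  exact le_ciSup (f := fun p => |h m p|) ⟨C, by rintro _ ⟨p, rfl⟩; exact hC p⟩ p
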